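/- Let $N,d\ge 1$, $\hbar>0$ and $T=\frac{\pi\hbar^2}{2}$, and let $\rho$ be a probability measure on $\mathbb{R}^d$. Write $C(r_1,\dots,r_N)=\sum_{1\le i<j\le N}\frac{1}{|r_i-r_j|}$ for the Coulomb repulsion on $\mathbb{R}^{Nd}$, and let $\Pi(\rho)$ be the set of probability measures on $\mathbb{R}^{Nd}$ that are symmetric under exchange of the $N$ particles and whose $N$ marginals are all equal to $\rho$. Define the Levy–Lieb functional $$F^{LL}[\rho]=\inf\Big\{\frac{\hbar^2}{2}\int_{\mathbb{R}^{Nd}}|\nabla\psi|^2\,dr+\int_{\mathbb{R}^{Nd}} C\,|\psi|^2\,dr\ :\ \psi\in H^1(\mathbb{R}^{Nd};\mathbb{R}),\ |\psi|^2\,dr\in\Pi(\rho)\Big\}\in[0,+\infty]$$ (with $\inf\emptyset=+\infty$), the reference measure $$\eta_T=\exp\Big(-\sum_{i<j}\frac{1}{T|r_i-r_j|}\Big)\,dr_1\cdots dr_N ,$$ and the entropic transport value $$\mathscr{S}_{N,T}[\rho]=\inf_{\gamma\in\Pi(\rho)}\mathcal{H}(\gamma|\eta_T)\in[-\infty,+\infty],\qquad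 \mathcal{H}(\gamma|\eta)=\int\log\frac{d\gamma}{d\eta}\,d\gamma,$$ where $\mathcal{H}(\gamma|\eta)=+\infty$ if $\gamma$ is not absolutely continuous with respect to $\eta$ or if the positive part of $\log\frac{d\gamma}{d\eta}$ is not $\gamma$-integrable. Then $$F^{LL}[\rho]\ \ge\ T\,\mathscr{S}_{N,T}[\rho].$$ Moreover, if $T\ge 1$ (for instance in atomic units, $\hbar=1$), then also $F^{LL}[\rho]\ge\mathscr{S}_{N,T}[\rho]$. -/

import Mathlib

open MeasureTheory
open scoped ENNReal ContDiff

noncomputable section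

namespace EntropicBound

/-- The configuration space `ℝ^{Nd}` of `N` particles in `ℝ^d`, with its Euclidean norm and
Lebesgue measure. The coordinate `(i, k)` is the `k`-th coordinate of the `i`-th particle. -/
abbrev Config (N d : ℕ) : Type := EuclideanSpace ℝ (Fin N × Fin d)

/-- The position `r_i ∈ ℝ^d` of the `i`-th particle. -/
def position {N d : ℕ} (i : Fin N) (r : Config N d) : EuclideanSpace ℝ (Fin d) :=
  WithLp.toLp 2 (fun k => r (i, k))

/-- Exchange of particles: the `i`-th particle of `permute σ r` is the `σ i`-th one of `r`. -/
def permute {N d : ℕ} (σ : Equiv.Perm (Fin N)) (r : Config N d) : Config N d :=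
  WithLp.toLp 2 (fun p => r (σ p.1, p.2))

/-- The Coulomb repulsion `∑_{i<j} 1 / |r_i - r_j|`, equal to `+∞` when two particles coincide. -/
def coulomb {N d : ℕ} (r : Config N d) : ℝ≥0∞ :=
  ∑ i : Fin N, ∑ j ∈ Finset.Ioi i, (ENNReal.ofReal ‖position i r - position j r‖)⁻¹

/-- `Π(ℝ^{Nd}, ρ)`: the symmetric probability measures on `ℝ^{Nd}`
all of whose `N` marginals are `ρ`. -/
structure IsPlan {N d : ℕ} (ρ : Measure (EuclideanSpace ℝ (Fin d)))
    (γ : Measure (Config N d)) : Prop where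
  isProbabilityMeasure : IsProbabilityMeasure γ
  marginal : ∀ i : Fin N, γ.map (position i) = ρ
  symmetric : ∀ σ : Equiv.Perm (Fin N), γ.map (permute σ) = γ

/-- `G` is the weak (distributional) gradient of `f`. -/
structure HasWeakGradient {N d : ℕ} (f : Config N d → ℝ) (G : Config N d → Config N d) :
    Prop where
  locallyIntegrable : LocallyIntegrable f
  locallyIntegrable_grad : LocallyIntegrable G
  integral_eq : ∀ φ : Config N d → ℝ, ContDiff ℝ ∞ φ → HasCompactSupport φ →
    ∀ v : Config N d, ∫ r, f r * fderiv ℝ φ r v = -∫ r, φ r * inner ℝ (G r) v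

/-- The Sobolev space `H¹(ℝ^{Nd}; ℝ)`. -/
def MemH1 {N d : ℕ} (f : Config N d → ℝ) : Prop :=
  MemLp f 2 ∧ ∃ G : Config N d → Config N d, MemLp G 2 ∧ HasWeakGradient f G

/-- `∫ |∇f|²` with `∇f` the weak gradient, which is unique up to null sets
(`+∞` if there is none). -/
def dirichletEnergy {N d : ℕ} (f : Config N d → ℝ) : ℝ≥0∞ :=
  ⨅ (G : Config N d → Config N d) (_ : HasWeakGradient f G), ∫⁻ r, ‖G r‖ₑ ^ 2

/-- The probability distribution `|ψ|² dr` of a real wavefunction. -/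
def bornMeasure {N d : ℕ} (ψ : Config N d → ℝ) : Measure (Config N d) :=
  volume.withDensity (fun r => ENNReal.ofReal (ψ r ^ 2))

/-- The Levy-Lieb functional: the infimum of kinetic plus Coulomb energy over the wavefunctions
`ψ ∈ H¹(ℝ^{Nd}; ℝ)` with `|ψ|² ∈ Π(ℝ^{Nd}, ρ)` (`+∞` if there is none). -/
def levyLieb (N : ℕ) {d : ℕ} (hbar : ℝ) (ρ : Measure (EuclideanSpace ℝ (Fin d))) : ℝ≥0∞ :=
  ⨅ (ψ : Config N d → ℝ) (_ : MemH1 ψ) (_ : IsPlan ρ (bornMeasure ψ)),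
    ENNReal.ofReal (hbar ^ 2 / 2) * dirichletEnergy ψ + ∫⁻ r, coulomb r ∂(bornMeasure ψ)

/-- The nonnegative wavefunctions `ψ = √g` are admissible, so the infimum over plan densities `g`
of the same energy, with kinetic part `(ħ²/2) ∫ |∇√g|²`, is at least `levyLieb`. -/
theorem levyLieb_le_plan_form {N d : ℕ} (hbar : ℝ) (ρ : Measure (EuclideanSpace ℝ (Fin d))) :
    levyLieb N hbar ρ ≤
      ⨅ (g : Config N d → ℝ) (_ : ∀ r, 0 ≤ g r) (_ : MemH1 (fun r => √(g r)))
        (_ : IsPlan ρ (volume.withDensity (fun r => ENNReal.ofReal (g r)))),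
        ENNReal.ofReal (hbar ^ 2 / 2) * dirichletEnergy (fun r => √(g r)) +
          ∫⁻ r, coulomb r ∂(volume.withDensity (fun r => ENNReal.ofReal (g r))) := by
  refine le_iInf fun g => le_iInf fun hg => le_iInf fun h1 => le_iInf fun h2 => ?_
  have hb : bornMeasure (fun r => √(g r)) =
      volume.withDensity (fun r => ENNReal.ofReal (g r)) := by
    unfold bornMeasure
    congr 1
    funext r
    rw [Real.sq_sqrt (hg r)]
  rw [← hb] at h2 ⊢
  exact iInf_le_of_le _ (iInf_le_of_le h1 (iInf_le_of_le h2 le_rfl))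

/-- The relative entropy `H(μ|ν) = ∫ log (dμ/dν) dμ`, with values in `[-∞, +∞]` (the reference
measure `ν` may be infinite). It is `+∞` if `μ` is not absolutely continuous with respect to `ν`
or if the positive part of the logarithm has infinite integral; otherwise it is the integral of
the positive part minus that of the negative part. -/
def relEntropy {α : Type*} [MeasurableSpace α] (μ ν : Measure α) : EReal :=
  open scoped Classical in
  if μ ≪ ν ∧ ∫⁻ x, ENNReal.ofReal (llr μ ν x) ∂μ ≠ ⊤ then
    ((∫⁻ x, ENNReal.ofReal (llr μ ν x) ∂μ : ℝ≥0∞) : EReal) -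
      ((∫⁻ x, ENNReal.ofReal (-llr μ ν x) ∂μ : ℝ≥0∞) : EReal)
  else ⊤

/-- The reference measure `η_T = exp (-∑_{i<j} 1 / (T |r_i - r_j|)) dr_1 ⋯ dr_N`. -/
def refMeasure (N d : ℕ) (T : ℝ) : Measure (Config N d) :=
  volume.withDensity
    (fun r => EReal.exp (-((coulomb r / ENNReal.ofReal T : ℝ≥0∞) : EReal)))

/-- The entropic transport value `S_{N,T}[ρ] = inf_{γ ∈ Π(ℝ^{Nd}, ρ)} H(γ | η_T)`. -/
def entropicValue (N : ℕ) {d : ℕ} (T : ℝ) (ρ : Measure (EuclideanSpace ℝ (Fin d))) : EReal :=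
  ⨅ (γ : Measure (Config N d)) (_ : IsPlan ρ γ), relEntropy γ (refMeasure N d T)

end EntropicBound

end

/-! For each admissible `ψ` the plan `|ψ|² dr` is a competitor in the entropic problem, with `log
(dγ/dη_T) = log ψ² + C/T`. It therefore suffices to show `∫ ψ² log ψ² ≤ π⁻¹ ∫ |∇ψ|²`: multiplied by
`T = πħ²/2`, the entropy bound becomes exactly the kinetic plus Coulomb energy.

This inequality comes from an elementary argument instead of a logarithmic Sobolev inequality. On a
line, `v(0)² ≤ ∫ |v v'|`, hence `f² ≤ ∫ |f ∂ₖf| dxₖ` almost everywhere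
(`ae_enorm_sq_le_lintegral_line`). Let `ρ_t` be `f²` with the coordinates outside `t` integrated
out, and `e` the same marginal of `|∂ₖf|²`. By Cauchy–Schwarz, `ρ_{t ∪ {k}} ≤ √(ρ_t e) ≤ ρ_t exp(π⁻¹
e/ρ_t)`, the last step because `πy ≤ exp(2y)`. Adding one coordinate at a time, from `ρ_∅ ≤ 1` up to
`f²`, bounds `log f²` by a sum `U` of terms `π⁻¹ e/ρ_t`. Each of them integrates against `f²` to at
most `π⁻¹ ∫ |∂ₖf|²` (`exists_log_bound`).

The bound `U + C/T` is nonnegative, so it controls the positive part of the logarithm; the negative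
part only lowers the entropy. -/

namespace EntropicBound

/-! ### The sup bound on the line -/

theorem enorm_sq_le_add_setLIntegral {a b : ℝ} {u F : ℝ → ℝ}
    (hu : ∀ x y, IntervalIntegrable u volume x y) (hF : ∀ t, F t = a + ∫ s in 0..t, u s) :
    ‖a‖ₑ ^ 2 ≤ ‖F b‖ₑ ^ 2 + 2 * ∫⁻ t in Set.uIoc 0 b, ‖F t‖ₑ * ‖u t‖ₑ := by
  have hac : AbsolutelyContinuousOnInterval F 0 b := by
    have h1 := (hu 0 b).absolutelyContinuousOnInterval_intervalIntegral (c := 0) (by simp)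
    have h2 : AbsolutelyContinuousOnInterval (fun _ : ℝ => a) 0 b :=
      (LipschitzWith.const a).lipschitzOnWith.absolutelyContinuousOnInterval
    have : F = fun t => a + ∫ s in 0..t, u s := funext hF
    rw [this]
    exact h2.fun_add h1
  have hder : ∀ᵐ t, t ∈ Set.uIoc 0 b → deriv F t = u t := by
    filter_upwards [(hu 0 b).ae_hasDerivAt_integral] with t ht h
    have := (ht (Set.uIoc_subset_uIcc h) 0 (by simp)).const_add a
    rw [← this.deriv]
    congr 1
    exact funext hF
  have key := hac.integral_deriv_mul_eq_sub hac
  have h0 : F 0 = a := by simp [hF]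
  rw [h0] at key
  have h1 : ∫ t in (0 : ℝ)..b, deriv F t * F t + F t * deriv F t =
      2 * ∫ t in (0 : ℝ)..b, F t * u t := by
    rw [← intervalIntegral.integral_const_mul]
    refine intervalIntegral.integral_congr_ae ?_
    filter_upwards [hder] with t ht h
    rw [ht h]; ring
  rw [h1] at key
  have h2 : a ^ 2 = F b ^ 2 - 2 * ∫ t in (0 : ℝ)..b, F t * u t := by rw [key]; ring
  have h3 : ‖∫ t in (0 : ℝ)..b, F t * u t‖ₑ ≤ ∫⁻ t in Set.uIoc 0 b, ‖F t‖ₑ * ‖u t‖ₑ := by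
    rw [← ofReal_norm, intervalIntegral.norm_intervalIntegral_eq, ofReal_norm]
    refine (enorm_integral_le_lintegral_enorm _).trans_eq ?_
    simp [enorm_mul]
  calc ‖a‖ₑ ^ 2 = ‖F b ^ 2 - 2 * ∫ t in (0 : ℝ)..b, F t * u t‖ₑ := by rw [← h2, enorm_pow]
    _ ≤ ‖F b ^ 2‖ₑ + ‖2 * ∫ t in (0 : ℝ)..b, F t * u t‖ₑ := enorm_sub_le
    _ ≤ _ := by
      rw [enorm_pow, enorm_mul]
      gcongr
      simp [Real.enorm_eq_ofReal]

/-- `S` stands for a half-line from `0`. Since `F ∈ L²` and `S` has infinite measure, `F²` is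
arbitrarily small somewhere on `S`; integrating `(F²)' = 2Fu` from `0` to such a point gives the
bound. -/
theorem enorm_sq_le_two_mul_setLIntegral {a : ℝ} {u F : ℝ → ℝ} {S : Set ℝ}
    (hu : ∀ x y, IntervalIntegrable u volume x y) (hF : ∀ t, F t = a + ∫ s in 0..t, u s)
    (hF2 : ∫⁻ t, ‖F t‖ₑ ^ 2 ≠ ⊤) (hS : MeasurableSet S) (hS' : volume S = ⊤)
    (hsub : ∀ b ∈ S, Set.uIoc 0 b ⊆ S) :
    ‖a‖ₑ ^ 2 ≤ 2 * ∫⁻ t in S, ‖F t‖ₑ * ‖u t‖ₑ := by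
  refine ENNReal.le_of_forall_pos_le_add fun ε hε _ => ?_
  have hex : ∃ b ∈ S, ‖F b‖ₑ ^ 2 ≤ ε := by
    by_contra! hcon
    refine hF2 (top_le_iff.1 ?_)
    calc ⊤ = (ε : ℝ≥0∞) * volume S := by
          rw [hS', ENNReal.mul_top (by exact_mod_cast hε.ne')]
      _ = ∫⁻ _ in S, (ε : ℝ≥0∞) := by rw [setLIntegral_const]
      _ ≤ ∫⁻ t in S, ‖F t‖ₑ ^ 2 := setLIntegral_mono' hS fun t ht => (hcon t ht).le
      _ ≤ _ := setLIntegral_le_lintegral _ _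
  obtain ⟨b, hb, hb'⟩ := hex
  calc _ ≤ _ := enorm_sq_le_add_setLIntegral (b := b) hu hF
    _ ≤ ε + 2 * ∫⁻ t in S, ‖F t‖ₑ * ‖u t‖ₑ := by
      gcongr
      exact hsub b hb
    _ = _ := add_comm _ _

/-- One-dimensional sup bound: an absolutely continuous function `v ∈ L²(ℝ)` with derivative `u`
satisfies `v(0)² ≤ ∫ |v u|`. -/
theorem enorm_sq_le_lintegral_mul {a : ℝ} {u v : ℝ → ℝ}
    (hu : ∀ x y, IntervalIntegrable u volume x y) (hv : ∀ᵐ t, v t = a + ∫ s in 0..t, u s)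
    (hv2 : ∫⁻ t, ‖v t‖ₑ ^ 2 ≠ ⊤) :
    ‖a‖ₑ ^ 2 ≤ ∫⁻ t, ‖v t‖ₑ * ‖u t‖ₑ := by
  set F : ℝ → ℝ := fun t => a + ∫ s in 0..t, u s with hF
  have e1 : ∫⁻ t, ‖v t‖ₑ ^ 2 = ∫⁻ t, ‖F t‖ₑ ^ 2 :=
    lintegral_congr_ae (hv.mono fun t ht => by simp only [ht, hF])
  have e2 : ∫⁻ t, ‖v t‖ₑ * ‖u t‖ₑ = ∫⁻ t, ‖F t‖ₑ * ‖u t‖ₑ :=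
    lintegral_congr_ae (hv.mono fun t ht => by simp only [ht, hF])
  rw [e1] at hv2
  rw [e2]
  have h1 := enorm_sq_le_two_mul_setLIntegral (S := Set.Ioi 0) hu (fun _ => rfl) hv2
    measurableSet_Ioi (by simp) (fun b hb => by
      rw [Set.uIoc_of_le (le_of_lt hb)]; exact fun x hx => hx.1)
  have h2 := enorm_sq_le_two_mul_setLIntegral (S := Set.Iic 0) hu (fun _ => rfl) hv2
    measurableSet_Iic (by simp) (fun b hb => by
      rw [Set.uIoc_of_ge hb]; exact fun x hx => hx.2)
  have h3 := lintegral_add_compl (μ := volume) (fun t => ‖F t‖ₑ * ‖u t‖ₑ)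
    (measurableSet_Ioi (a := (0 : ℝ)))
  rw [Set.compl_Ioi] at h3
  rw [← h3]
  -- Adding the two half-line bounds gives `2a²` on the left, which cancels the factor `2` on the
  -- right.
  have h4 := add_le_add h1 h2
  rw [← two_mul, ← mul_add] at h4
  exact (ENNReal.mul_le_mul_iff_right (by simp) (by simp)).1 h4

/-! ### Restriction of Sobolev functions to lines -/

section Lines

variable {E : Type*} [NormedAddCommGroup E] [NormedSpace ℝ E] [FiniteDimensional ℝ E]
  [MeasurableSpace E] [BorelSpace E] {μ : Measure E} [μ.IsAddHaarMeasure]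

theorem mul_le_sq_add_sq (a b : ℝ≥0∞) : a * b ≤ a ^ 2 + b ^ 2 := by
  rcases le_total a b with h | h
  · calc a * b ≤ b * b := by gcongr
      _ = b ^ 2 := (sq b).symm
      _ ≤ _ := le_add_self
  · calc a * b ≤ a * a := by gcongr
      _ = a ^ 2 := (sq a).symm
      _ ≤ _ := le_self_add

theorem memLp_two_of_lintegral_ne_top {α : Type*} [MeasurableSpace α] {ν : Measure α}
    {f : α → ℝ} (hf : Measurable f) (hf2 : ∫⁻ x, ‖f x‖ₑ ^ 2 ∂ν ≠ ⊤) : MemLp f 2 ν := by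
  refine ⟨hf.aestronglyMeasurable, ?_⟩
  rw [eLpNorm_lt_top_iff_lintegral_rpow_enorm_lt_top (by simp) (by simp)]
  simpa using hf2.lt_top

theorem lintegral_sq_ne_top_of_memLp {α : Type*} [MeasurableSpace α] {ν : Measure α}
    {F : Type*} [NormedAddCommGroup F] {f : α → F}
    (hf : MemLp f 2 ν) : ∫⁻ x, ‖f x‖ₑ ^ 2 ∂ν ≠ ⊤ := by
  have := hf.2
  rw [eLpNorm_lt_top_iff_lintegral_rpow_enorm_lt_top (by simp) (by simp)] at this
  simpa using this.ne

theorem integrable_mul_translate {p q : E → ℝ} (hp : Measurable p) (hq : Measurable q)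
    (hp2 : ∫⁻ x, ‖p x‖ₑ ^ 2 ∂μ ≠ ⊤) (hq2 : ∫⁻ x, ‖q x‖ₑ ^ 2 ∂μ ≠ ⊤) (e : E) (a b : ℝ) :
    Integrable (Function.uncurry fun (t : ℝ) (x : E) => p x * q (x + t • e))
      ((volume.restrict (Set.uIoc a b)).prod μ) := by
  have hm : Measurable (Function.uncurry fun (t : ℝ) (x : E) => p x * q (x + t • e)) := by
    unfold Function.uncurry; fun_prop
  refine ⟨hm.aestronglyMeasurable, ?_⟩
  rw [HasFiniteIntegral, lintegral_prod _ hm.enorm.aemeasurable]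
  calc ∫⁻ (t : ℝ) in Set.uIoc a b, ∫⁻ x, ‖p x * q (x + t • e)‖ₑ ∂μ
      ≤ ∫⁻ (t : ℝ) in Set.uIoc a b, (∫⁻ x, ‖p x‖ₑ ^ 2 ∂μ + ∫⁻ x, ‖q x‖ₑ ^ 2 ∂μ) := by
        refine lintegral_mono fun t => ?_
        rw [← lintegral_add_right_eq_self (μ := μ) (fun x => ‖q x‖ₑ ^ 2) (t • e),
          ← lintegral_add_left (by fun_prop)]
        refine lintegral_mono fun x => ?_
        rw [enorm_mul]
        exact mul_le_sq_add_sq _ _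
    _ < ⊤ := by
        rw [setLIntegral_const]
        exact ENNReal.mul_lt_top (ENNReal.add_lt_top.2 ⟨hp2.lt_top, hq2.lt_top⟩) (by simp)

/-- A function in `L²` with weak directional derivative `u ∈ L²` along `e` is recovered from `u`
by integration along segments. -/
theorem ae_eq_add_intervalIntegral {f u : E → ℝ} {e : E} (hf : Measurable f) (hu : Measurable u)
    (hf2 : ∫⁻ x, ‖f x‖ₑ ^ 2 ∂μ ≠ ⊤) (hu2 : ∫⁻ x, ‖u x‖ₑ ^ 2 ∂μ ≠ ⊤)
    (hw : ∀ φ : E → ℝ, ContDiff ℝ ∞ φ → HasCompactSupport φ →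
      ∫ x, f x * fderiv ℝ φ x e ∂μ = -∫ x, φ x * u x ∂μ) (h : ℝ) :
    ∀ᵐ x ∂μ, f (x + h • e) = f x + ∫ t in 0..h, u (x + t • e) := by
  have hfL := memLp_two_of_lintegral_ne_top hf hf2
  have hf1 : LocallyIntegrable f μ := hfL.locallyIntegrable (by norm_num)
  have hmp : MeasurePreserving (fun x : E => x + h • e) μ μ := measurePreserving_add_right μ _
  have hfh : LocallyIntegrable (fun x => f (x + h • e)) μ :=
    (hfL.comp_measurePreserving hmp).locallyIntegrable (by norm_num)
  have hA : LocallyIntegrable (fun x => ∫ t in 0..h, u (x + t • e)) μ := by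
    rw [locallyIntegrable_iff]
    intro K hK
    have h1 := (integrable_mul_translate (μ := μ) (p := K.indicator 1) (q := u)
      (measurable_one.indicator hK.measurableSet) hu (by
        have : ∀ x, ‖K.indicator (1 : E → ℝ) x‖ₑ ^ 2 = K.indicator (1 : E → ℝ≥0∞) x := by
          intro x; by_cases hx : x ∈ K <;> simp [hx]
        simp_rw [this]
        rw [lintegral_indicator_one hK.measurableSet]
        exact hK.measure_lt_top.ne) hu2 e 0 h).integral_prod_right
    have h2 : Integrable (K.indicator fun x => ∫ t in 0..h, u (x + t • e)) μ := by
      -- The sign accounts for the orientation of `0..h`: the product integral over `Set.uIoc 0 h`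
      -- is unoriented.
      have h3 := h1.const_mul (if (0 : ℝ) ≤ h then 1 else -1)
      refine h3.congr (Filter.Eventually.of_forall fun x => ?_)
      by_cases hx : x ∈ K
      · simp [hx, Function.uncurry, intervalIntegral.intervalIntegral_eq_integral_uIoc]
      · simp [hx, Function.uncurry]
    exact (integrable_indicator_iff hK.measurableSet).1 h2
  refine ae_eq_of_integral_contDiff_smul_eq hfh (hf1.add hA) fun φ hφ hφc => ?_
  simp only [smul_eq_mul]
  have hφ1 : ContDiff ℝ 1 φ := hφ.of_le (by simp)
  have hφd : Continuous fun x => fderiv ℝ φ x e := by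
    have := hφ1.continuous_fderiv (by simp); fun_prop
  have hφdc : HasCompactSupport fun x => fderiv ℝ φ x e := hφc.fderiv_apply ℝ e
  have hφL : MemLp φ 2 μ := hφ.continuous.memLp_of_hasCompactSupport hφc
  have hφdL : MemLp (fun x => fderiv ℝ φ x e) 2 μ := hφd.memLp_of_hasCompactSupport hφdc
  have hint1 := integrable_mul_translate (μ := μ) hf hφd.measurable hf2
    (lintegral_sq_ne_top_of_memLp hφdL) (-e) 0 h
  have hint2 := integrable_mul_translate (μ := μ) hφ.continuous.measurable hu
    (lintegral_sq_ne_top_of_memLp hφL) hu2 e 0 h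
  -- Translations are moved from `f` to the test function, which turns `e` into `-e`; the
  -- fundamental theorem of calculus is then needed only for the smooth `φ`.
  have hftc : ∀ x, φ (x + h • (-e)) - φ x = -∫ t in 0..h, fderiv ℝ φ (x + t • (-e)) e := by
    intro x
    have hd : ∀ t : ℝ, HasDerivAt (fun t : ℝ => φ (x + t • (-e)))
        (-fderiv ℝ φ (x + t • (-e)) e) t := by
      intro t
      have h1 : HasDerivAt (fun t : ℝ => x + t • (-e)) (-e) t := by
        simpa using ((hasDerivAt_id t).smul_const (-e)).const_add x
      have h2 := ((hφ1.differentiable (by simp)) (x + t • (-e))).hasFDerivAt.comp_hasDerivAt t h1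
      exact h2.congr_deriv (by simp)
    have := intervalIntegral.integral_eq_sub_of_hasDerivAt (a := 0) (b := h) (fun t _ => hd t)
      (Continuous.intervalIntegrable (by fun_prop) _ _)
    rw [intervalIntegral.integral_neg] at this
    simp only [zero_smul, add_zero] at this
    exact this.symm
  have hstep : ∀ t : ℝ, ∫ x, f x * fderiv ℝ φ (x + t • (-e)) e ∂μ
      = -∫ x, φ x * u (x + t • e) ∂μ := by
    intro t
    have h1 := hw (fun x => φ (x + t • (-e))) (hφ.comp (by fun_prop))
      (hφc.comp_homeomorph (Homeomorph.addRight (t • (-e))))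
    have h2 : ∀ x, fderiv ℝ (fun x => φ (x + t • (-e))) x e = fderiv ℝ φ (x + t • (-e)) e := by
      intro x; rw [fderiv_comp_add_right]
    simp_rw [h2] at h1
    rw [h1, ← integral_add_right_eq_self (μ := μ) (fun x => φ (x + t • -e) * u x) (t • e)]
    simp
  have e1 : ∫ x, φ x * f (x + h • e) ∂μ = ∫ x, f x * φ (x + h • (-e)) ∂μ := by
    rw [← integral_add_right_eq_self (μ := μ) (fun x => f x * φ (x + h • (-e))) (h • e)]
    simp [mul_comm]
  have i1 : Integrable (fun x => f x * φ (x + h • (-e))) μ :=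
    hfL.integrable_mul (hφL.comp_measurePreserving (measurePreserving_add_right μ (h • (-e))))
  have i2 : Integrable (fun x => f x * φ x) μ := hfL.integrable_mul hφL
  have hs1 := intervalIntegral_integral_swap hint1
  have hs2 := intervalIntegral_integral_swap hint2
  have e2 : ∫ x, f x * φ (x + h • (-e)) ∂μ - ∫ x, f x * φ x ∂μ
      = ∫ x, φ x * (∫ t in 0..h, u (x + t • e)) ∂μ := by
    rw [← integral_sub i1 i2]
    calc ∫ x, (f x * φ (x + h • (-e)) - f x * φ x) ∂μ
        = ∫ x, -(∫ t in 0..h, f x * fderiv ℝ φ (x + t • (-e)) e) ∂μ := by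
          congr 1; ext x
          rw [← mul_sub, hftc, intervalIntegral.integral_const_mul]; ring
      _ = -∫ t in 0..h, ∫ x, f x * fderiv ℝ φ (x + t • (-e)) e ∂μ := by
          rw [integral_neg, hs1]
      _ = ∫ t in 0..h, ∫ x, φ x * u (x + t • e) ∂μ := by
          simp_rw [hstep]
          rw [intervalIntegral.integral_neg, neg_neg]
      _ = _ := by
          rw [hs2]
          simp_rw [intervalIntegral.integral_const_mul]
  have i3 : Integrable (fun x => φ x * ∫ t in 0..h, u (x + t • e)) μ := by
    have h3 := hint2.integral_prod_right.const_mul (if (0 : ℝ) ≤ h then 1 else -1)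
    refine h3.congr (Filter.Eventually.of_forall fun x => ?_)
    simp [Function.uncurry, intervalIntegral.intervalIntegral_eq_integral_uIoc,
      integral_const_mul]
  have e3 : ∫ x, φ x * (f x + ∫ t in 0..h, u (x + t • e)) ∂μ
      = ∫ x, f x * φ x ∂μ + ∫ x, φ x * (∫ t in 0..h, u (x + t • e)) ∂μ := by
    rw [← integral_add i2 i3]
    congr 1; ext x; ring
  rw [e1, e3, ← e2]; ring

/-- Joint measurability in the base point and the length is what allows exchanging "for almost every
`h`" and "for almost every `x`". -/
theorem measurable_intervalIntegral_line {u : E → ℝ} (hu : Measurable u) (e : E) :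
    Measurable fun p : E × ℝ => ∫ t in 0..p.2, u (p.1 + t • e) := by
  have key : ∀ a b : E × ℝ → ℝ, Measurable a → Measurable b →
      Measurable fun p : E × ℝ => ∫ t in Set.Ioc (a p) (b p), u (p.1 + t • e) := by
    intro a b ha hb
    have hS : MeasurableSet {q : (E × ℝ) × ℝ | q.2 ∈ Set.Ioc (a q.1) (b q.1)} :=
      (measurableSet_lt (ha.comp measurable_fst) measurable_snd).inter
        (measurableSet_le measurable_snd (hb.comp measurable_fst))
    have hm : StronglyMeasurable ({q : (E × ℝ) × ℝ | q.2 ∈ Set.Ioc (a q.1) (b q.1)}.indicator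
        fun q => u (q.1.1 + q.2 • e)) :=
      (Measurable.indicator (by fun_prop) hS).stronglyMeasurable
    have := (hm.integral_prod_right' (ν := (volume : Measure ℝ))).measurable
    convert this using 2 with p
    rw [← integral_indicator measurableSet_Ioc]
    rfl
  exact (key _ _ measurable_const measurable_snd).sub (key _ _ measurable_snd measurable_const)

theorem ae_intervalIntegrable_line {u : E → ℝ} (hu : Measurable u)
    (hu2 : ∫⁻ x, ‖u x‖ₑ ^ 2 ∂μ ≠ ⊤) (e : E) :
    ∀ᵐ x ∂μ, ∀ a b, IntervalIntegrable (fun t : ℝ => u (x + t • e)) volume a b := by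
  have h1 : ∀ n : ℕ, ∀ᵐ x ∂μ, ∫⁻ t in Set.Icc (-n : ℝ) n, ‖u (x + t • e)‖ₑ ^ 2 < ⊤ := by
    intro n
    refine ae_lt_top (by fun_prop) ?_
    rw [lintegral_lintegral_swap (by fun_prop)]
    have : ∀ t : ℝ, ∫⁻ x, ‖u (x + t • e)‖ₑ ^ 2 ∂μ = ∫⁻ x, ‖u x‖ₑ ^ 2 ∂μ := fun t =>
      lintegral_add_right_eq_self (μ := μ) (fun x => ‖u x‖ₑ ^ 2) (t • e)
    simp_rw [this]
    rw [setLIntegral_const]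
    exact ENNReal.mul_ne_top hu2 (by simp)
  filter_upwards [ae_all_iff.2 h1] with x hx a b
  obtain ⟨n, hn⟩ := exists_nat_ge (max |a| |b|)
  have hsub : Set.uIoc a b ⊆ Set.Icc (-n : ℝ) n := by
    intro t ht
    have h2 := Set.uIoc_subset_uIcc ht
    have ha := abs_le.1 ((le_max_left _ _).trans hn)
    have hb := abs_le.1 ((le_max_right _ _).trans hn)
    exact (Set.uIcc_subset_Icc ⟨ha.1, ha.2⟩ ⟨hb.1, hb.2⟩) h2
  rw [intervalIntegrable_iff]
  have hm : Measurable fun t : ℝ => u (x + t • e) := by fun_prop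
  have hL : MemLp (fun t : ℝ => u (x + t • e)) 2 (volume.restrict (Set.Icc (-n : ℝ) n)) := by
    refine ⟨hm.aestronglyMeasurable, ?_⟩
    rw [eLpNorm_lt_top_iff_lintegral_rpow_enorm_lt_top (by simp) (by simp)]
    simpa using hx n
  exact IntegrableOn.mono_set (hL.integrable (by norm_num)) hsub

theorem ae_enorm_sq_le_lintegral_line {f u : E → ℝ} {e : E} (hf : Measurable f)
    (hu : Measurable u)
    (hf2 : ∫⁻ x, ‖f x‖ₑ ^ 2 ∂μ ≠ ⊤) (hu2 : ∫⁻ x, ‖u x‖ₑ ^ 2 ∂μ ≠ ⊤)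
    (hw : ∀ φ : E → ℝ, ContDiff ℝ ∞ φ → HasCompactSupport φ →
      ∫ x, f x * fderiv ℝ φ x e ∂μ = -∫ x, φ x * u x ∂μ) :
    ∀ᵐ x ∂μ, ∫⁻ t : ℝ, ‖f (x + t • e)‖ₑ ^ 2 ≠ ⊤ →
      ‖f x‖ₑ ^ 2 ≤ ∫⁻ t : ℝ, ‖f (x + t • e)‖ₑ * ‖u (x + t • e)‖ₑ := by
  have h1 : ∀ᵐ h : ℝ, ∀ᵐ x ∂μ, f (x + h • e) = f x + ∫ t in 0..h, u (x + t • e) :=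
    Filter.Eventually.of_forall fun h => ae_eq_add_intervalIntegral hf hu hf2 hu2 hw h
  have hm := measurable_intervalIntegral_line hu e
  have hms : MeasurableSet {p : ℝ × E |
      f (p.2 + p.1 • e) = f p.2 + ∫ t in 0..p.1, u (p.2 + t • e)} :=
    measurableSet_eq_fun (by fun_prop)
      ((hf.comp measurable_snd).add (hm.comp measurable_swap))
  -- The null set of base points depends on `h`; Fubini gives, for almost every `x`, the identity
  -- for almost every `h`.
  have h2 := (Measure.ae_ae_comm hms).1 h1
  filter_upwards [h2, ae_intervalIntegrable_line hu hu2 e] with x hx hx' hx2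
  exact enorm_sq_le_lintegral_mul hx' hx hx2

end Lines

/-! ### Partial integrals and the logarithmic bound -/

section Marginal

variable {ι : Type*} [Fintype ι] [DecidableEq ι]

/-- The marginal is constant in the coordinates of `s`, so its full integral is not that of `F`.
Integrating it over `sᶜ` does give `∫ F = 0`, and a further integration over `s` keeps `0`. -/
theorem lintegral_lmarginal_eq_zero {F : (ι → ℝ) → ℝ≥0∞} (hF : Measurable F)
    (h0 : ∫⁻ x, F x = 0) (s : Finset ι) :
    ∫⁻ x, lmarginal (fun _ => (volume : Measure ℝ)) s F x = 0 := by
  have h1 : lmarginal (fun _ => (volume : Measure ℝ)) sᶜ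
      (lmarginal (fun _ => (volume : Measure ℝ)) s F) = 0 := by
    rw [← lmarginal_union _ _ hF disjoint_compl_left, Finset.union_comm, Finset.union_compl, lmarginal_univ]
    ext x; simpa [← volume_pi] using h0
  have h2 := lintegral_eq_of_lmarginal_eq (μ := fun _ : ι => (volume : Measure ℝ)) sᶜ
    (hF.lmarginal (s := s) (fun _ => volume)) (measurable_zero)
    (by rw [h1]; ext x; simp [lmarginal])
  rw [volume_pi, h2]; simp

/-- The exceptional set is null, hence so are almost all of its slices along `s`. -/
theorem lmarginal_ae_mono {F H : (ι → ℝ) → ℝ≥0∞} (hFH : ∀ᵐ x, F x ≤ H x) (s : Finset ι) :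
    ∀ᵐ x, lmarginal (fun _ => (volume : Measure ℝ)) s F x ≤
      lmarginal (fun _ => (volume : Measure ℝ)) s H x := by
  obtain ⟨N, hN, hNm, hN0⟩ := exists_measurable_superset_of_null (ae_iff.1 hFH)
  have h1 := lintegral_lmarginal_eq_zero (measurable_one.indicator hNm)
    (by rw [lintegral_indicator_one hNm, hN0]) s
  rw [lintegral_eq_zero_iff ((measurable_one.indicator hNm).lmarginal _)] at h1
  filter_upwards [h1] with x hx
  simp only [lmarginal, Pi.zero_apply] at hx ⊢
  rw [lintegral_eq_zero_iff (f := fun y => N.indicator 1 (Function.updateFinset x s y))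
    ((measurable_one.indicator hNm).comp measurable_updateFinset)] at hx
  refine lintegral_mono_ae (hx.mono fun y hy => ?_)
  by_contra hcon
  have : Function.updateFinset x s y ∈ N := hN hcon
  simp [this] at hy

theorem ae_lmarginal_lt_top {F : (ι → ℝ) → ℝ≥0∞} (hF : Measurable F)
    (hfin : ∫⁻ x, F x ≠ ⊤) (s : Finset ι) :
    ∀ᵐ x, lmarginal (fun _ => (volume : Measure ℝ)) s F x < ⊤ := by
  set R := lmarginal (fun _ => (volume : Measure ℝ)) s F with hR
  have hRm : Measurable R := hF.lmarginal _
  have hAm : MeasurableSet {x | R x = ⊤} := hRm (measurableSet_singleton _)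
  set A : (ι → ℝ) → ℝ≥0∞ := {x | R x = ⊤}.indicator 1 with hA
  have hAm' : Measurable A := measurable_one.indicator hAm
  have h1 : lmarginal (fun _ => (volume : Measure ℝ)) sᶜ A = 0 := by
    ext x
    have h2 : lmarginal (fun _ => (volume : Measure ℝ)) sᶜ R x ≠ ⊤ := by
      rw [hR, ← lmarginal_union _ _ hF disjoint_compl_left, Finset.union_comm, Finset.union_compl, lmarginal_univ]
      simpa [← volume_pi] using hfin
    have h3 : Measurable fun y => R (Function.updateFinset x sᶜ y) :=
      hRm.comp measurable_updateFinset
    have h4 := ae_lt_top h3 h2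
    simp only [lmarginal, Pi.zero_apply]
    rw [lintegral_eq_zero_iff (f := fun y => A (Function.updateFinset x sᶜ y))
      (hAm'.comp measurable_updateFinset)]
    filter_upwards [h4] with y hy
    simp [hA, hy.ne]
  have h2 := lintegral_eq_of_lmarginal_eq (μ := fun _ : ι => (volume : Measure ℝ)) sᶜ
    hAm' (measurable_zero) (by rw [h1]; ext x; simp [lmarginal])
  rw [← volume_pi, lintegral_indicator_one hAm] at h2
  rw [ae_iff]
  simpa using h2

theorem lmarginal_mul_le_sqrt {ι : Type*} [DecidableEq ι] {a b : (ι → ℝ) → ℝ≥0∞} (ha : Measurable a) (hb : Measurable b)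
    (s : Finset ι) (x : ι → ℝ) :
    lmarginal (fun _ => (volume : Measure ℝ)) s (fun x => a x * b x) x ≤
      (lmarginal (fun _ => (volume : Measure ℝ)) s (fun x => a x ^ 2) x) ^ (1 / 2 : ℝ) *
      (lmarginal (fun _ => (volume : Measure ℝ)) s (fun x => b x ^ 2) x) ^ (1 / 2 : ℝ) := by
  have := ENNReal.lintegral_mul_le_Lp_mul_Lq
    (Measure.pi fun _ : s => (volume : Measure ℝ)) Real.HolderConjugate.two_two
    (ha.comp (measurable_updateFinset (x := x) (s := s))).aemeasurable
    (hb.comp (measurable_updateFinset (x := x) (s := s))).aemeasurable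
  simpa [lmarginal] using this

/-- The quotient is constant along `s`-fibres, so integrating `g` over a fibre cancels the
denominator. Only `≤` holds, since that denominator may be `0` or `∞`. -/
theorem lintegral_mul_lmarginal_div_le {g D : (ι → ℝ) → ℝ≥0∞} (hg : Measurable g)
    (hD : Measurable D) (s : Finset ι) :
    ∫⁻ x, g x * (lmarginal (fun _ => (volume : Measure ℝ)) s D x /
      lmarginal (fun _ => (volume : Measure ℝ)) s g x) ≤ ∫⁻ x, D x := by
  have hDm := hD.lmarginal (s := s) (fun _ => (volume : Measure ℝ))
  have hgm := hg.lmarginal (s := s) (fun _ => (volume : Measure ℝ))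
  refine lintegral_le_of_lmarginal_le (μ := fun _ : ι => (volume : Measure ℝ)) s
    (hg.mul (hDm.div hgm)) hD fun x => ?_
  have hc : ∀ (F : (ι → ℝ) → ℝ≥0∞) y,
      lmarginal (fun _ => (volume : Measure ℝ)) s F (Function.updateFinset x s y) =
        lmarginal (fun _ => (volume : Measure ℝ)) s F x := fun F y =>
    lmarginal_congr _ _ fun i hi => by simp [Function.updateFinset, hi]
  calc _ = ∫⁻ y : s → ℝ, g (Function.updateFinset x s y) *
        (lmarginal (fun _ => (volume : Measure ℝ)) s D x /
          lmarginal (fun _ => (volume : Measure ℝ)) s g x)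
          ∂(Measure.pi fun _ : s => (volume : Measure ℝ)) := by
        rw [lmarginal]; simp only [hc]
    _ = lmarginal (fun _ => (volume : Measure ℝ)) s g x *
        (lmarginal (fun _ => (volume : Measure ℝ)) s D x /
          lmarginal (fun _ => (volume : Measure ℝ)) s g x) := by
        rw [lintegral_mul_const (f := fun y => g (Function.updateFinset x s y)) _
          (hg.comp measurable_updateFinset)]; rfl
    _ ≤ _ := ENNReal.mul_div_le

/-- The tangent bound `exp(2y) ≥ 2e·y` is enough, because `2e > π`. -/
theorem pi_mul_le_exp_two_mul {y : ℝ} (hy : 0 ≤ y) : Real.pi * y ≤ Real.exp (2 * y) := by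
  have h1 := Real.add_one_le_exp (2 * y - 1)
  have h2 : Real.exp (2 * y) = Real.exp 1 * Real.exp (2 * y - 1) := by
    rw [← Real.exp_add]; congr 1; ring
  have h3 := Real.exp_one_gt_d9
  have h4 := Real.pi_lt_d2
  rw [h2]
  nlinarith [Real.exp_pos (2 * y - 1)]

/-- With `y = e/(πr)` one has `√(re) = r√(πy) ≤ r exp(y)`. The degenerate cases are consistent: `r =
0` forces `p = 0`, and `r = ∞` forces `V = ∞`. -/
theorem le_exp_add_of_le_sqrt_mul {p r e V : ℝ≥0∞}
    (hp : p ≤ r ^ (1 / 2 : ℝ) * e ^ (1 / 2 : ℝ)) (hr : r ≤ EReal.exp V) :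
    p ≤ EReal.exp ((V + ENNReal.ofReal (1 / Real.pi) * (e / r) : ℝ≥0∞) : EReal) := by
  have hpi : ENNReal.ofReal (1 / Real.pi) ≠ 0 := by
    simpa using Real.pi_pos
  rcases eq_or_ne r 0 with h0 | h0
  · subst h0
    simp at hp
    simp [hp]
  rcases eq_or_ne r ⊤ with h1 | h1
  · subst h1
    have : V = ⊤ := by simpa using hr
    simp [this]
  rcases eq_or_ne e ⊤ with h2 | h2
  · subst h2
    rw [ENNReal.top_div_of_ne_top h1, ENNReal.mul_top hpi]
    simp
  lift r to NNReal using h1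
  lift e to NNReal using h2
  have hr0 : 0 < (r : ℝ) := by
    have : r ≠ 0 := by exact_mod_cast h0
    exact_mod_cast pos_iff_ne_zero.2 this
  set y : ℝ := 1 / Real.pi * ((e : ℝ) / r) with hy
  have hy0 : 0 ≤ y := by positivity
  have hyE : ENNReal.ofReal (1 / Real.pi) * ((e : ℝ≥0∞) / r) = ENNReal.ofReal y := by
    rw [hy, ENNReal.ofReal_mul (by positivity), ENNReal.ofReal_div_of_pos hr0]
    simp
  rw [hyE, EReal.coe_ennreal_add, EReal.exp_add]
  have hey : EReal.exp ((ENNReal.ofReal y : ℝ≥0∞) : EReal) = ENNReal.ofReal (Real.exp y) := by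
    rw [EReal.coe_ennreal_ofReal, max_eq_left hy0, EReal.exp_coe]
  rw [hey]
  refine hp.trans (le_trans ?_ (mul_le_mul_left hr _))
  have h3 : (e : ℝ) = r * (Real.pi * y) := by rw [hy]; field_simp
  rw [← ENNReal.ofReal_coe_nnreal (p := r), ← ENNReal.ofReal_coe_nnreal (p := e),
    ENNReal.ofReal_rpow_of_nonneg (by positivity) (by norm_num),
    ENNReal.ofReal_rpow_of_nonneg (by positivity) (by norm_num),
    ← ENNReal.ofReal_mul (by positivity), ← ENNReal.ofReal_mul (by positivity)]
  refine ENNReal.ofReal_le_ofReal ?_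
  rw [← Real.sqrt_eq_rpow, ← Real.sqrt_eq_rpow, ← Real.sqrt_mul (by positivity)]
  refine Real.sqrt_le_iff.2 ⟨by positivity, ?_⟩
  have h4 : Real.exp y ^ 2 = Real.exp (2 * y) := by rw [← Real.exp_nat_mul]; simp
  have h5 := pi_mul_le_exp_two_mul hy0
  rw [mul_pow, h4]
  conv_lhs => rw [h3]
  calc (r : ℝ) * (r * (Real.pi * y)) = (r : ℝ) ^ 2 * (Real.pi * y) := by ring
    _ ≤ _ := by gcongr

/-- If `a² ≤ ∫ a bₖ dxₖ` almost everywhere for every coordinate `k` and `∫ a² ≤ 1`, then `log a²`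
has an upper bound `U ≥ 0` with `∫ a² U ≤ π⁻¹ ∑ₖ ∫ bₖ²`. -/
theorem exists_log_bound {a : (ι → ℝ) → ℝ≥0∞} {b : ι → (ι → ℝ) → ℝ≥0∞} (ha : Measurable a)
    (hb : ∀ k, Measurable (b k)) (ha1 : ∫⁻ x, a x ^ 2 ≤ 1)
    (h : ∀ k, ∀ᵐ x, a x ^ 2 ≤
      lmarginal (fun _ => (volume : Measure ℝ)) {k} (fun x => a x * b k x) x) :
    ∃ U : (ι → ℝ) → ℝ≥0∞, Measurable U ∧ (∀ᵐ x, a x ^ 2 ≤ EReal.exp (U x)) ∧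
      ∫⁻ x, a x ^ 2 * U x ≤ ENNReal.ofReal (1 / Real.pi) * ∑ k, ∫⁻ x, b k x ^ 2 := by
  have ha2 : Measurable fun x => a x ^ 2 := ha.pow_const 2
  -- Induction on the set `t` of coordinates not yet integrated out: `t = ∅` is the bound `∫ a² ≤ 1
  -- = exp 0`, and `t = univ` is the claim.
  suffices H : ∀ t : Finset ι, ∃ U : (ι → ℝ) → ℝ≥0∞, Measurable U ∧
      (∀ᵐ x, lmarginal (fun _ => (volume : Measure ℝ)) tᶜ (fun x => a x ^ 2) x
        ≤ EReal.exp (U x)) ∧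
      ∫⁻ x, a x ^ 2 * U x ≤ ENNReal.ofReal (1 / Real.pi) * ∑ k ∈ t, ∫⁻ x, b k x ^ 2 by
    simpa using H Finset.univ
  intro t
  induction t using Finset.induction_on with
  | empty =>
    refine ⟨0, measurable_zero, ?_, by simp⟩
    simpa [← volume_pi] using ha1
  | insert k t hk ih =>
    obtain ⟨U, hUm, hU, hUi⟩ := ih
    have hb2 : Measurable fun x => b k x ^ 2 := (hb k).pow_const 2
    have hρ := ha2.lmarginal (s := tᶜ) (fun _ => (volume : Measure ℝ))
    have he := hb2.lmarginal (s := tᶜ) (fun _ => (volume : Measure ℝ))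
    -- The cost of releasing coordinate `k`: `π⁻¹` times the ratio of the `tᶜ`-marginals of `bₖ²`
    -- and `a²`.
    set W : (ι → ℝ) → ℝ≥0∞ := fun x => ENNReal.ofReal (1 / Real.pi) *
      (lmarginal (fun _ => (volume : Measure ℝ)) tᶜ (fun x => b k x ^ 2) x /
        lmarginal (fun _ => (volume : Measure ℝ)) tᶜ (fun x => a x ^ 2) x) with hW
    have hWm : Measurable W := (he.div hρ).const_mul _
    have htc : tᶜ = (insert k t)ᶜ ∪ {k} := by
      ext i
      by_cases hi : i = k
      · simp [hi, hk]
      · simp [hi]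
    have hdisj : Disjoint (insert k t)ᶜ ({k} : Finset ι) := by simp
    refine ⟨fun x => U x + W x, hUm.add hWm, ?_, ?_⟩
    · filter_upwards [hU, lmarginal_ae_mono (h k) (insert k t)ᶜ] with x hx hx'
      refine le_exp_add_of_le_sqrt_mul (hx'.trans ?_) hx
      rw [← lmarginal_union _ (fun x => a x * b k x) (ha.mul (hb k)) hdisj, ← htc]
      exact lmarginal_mul_le_sqrt ha (hb k) _ x
    · simp_rw [mul_add]
      rw [lintegral_add_left (f := fun x => a x ^ 2 * U x) (ha2.mul hUm), Finset.sum_insert hk, mul_add, add_comm]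
      refine add_le_add ?_ hUi
      calc ∫⁻ x, a x ^ 2 * W x
          = ENNReal.ofReal (1 / Real.pi) * ∫⁻ x, a x ^ 2 *
            (lmarginal (fun _ => (volume : Measure ℝ)) tᶜ (fun x => b k x ^ 2) x /
            lmarginal (fun _ => (volume : Measure ℝ)) tᶜ (fun x => a x ^ 2) x) := by
            rw [← lintegral_const_mul' _ _ ENNReal.ofReal_ne_top]
            refine lintegral_congr fun x => ?_
            rw [hW]; ring
        _ ≤ _ := mul_le_mul_right (lintegral_mul_lmarginal_div_le ha2 hb2 _) _

end Marginal

/-! ### Transfer to the Euclidean configuration space -/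

section Config

variable {ι : Type*} [DecidableEq ι]

theorem toLp_update (x : ι → ℝ) (k : ι) (t : ℝ) :
    (WithLp.toLp 2 (Function.update x k (t + x k)) : EuclideanSpace ℝ ι) =
      WithLp.toLp 2 x + t • EuclideanSpace.single k (1 : ℝ) := by
  ext i
  by_cases hi : i = k
  · subst hi; simp [add_comm]
  · simp [hi]

theorem lmarginal_singleton_comp_toLp [Fintype ι] (F : EuclideanSpace ℝ ι → ℝ≥0∞) (k : ι) (x : ι → ℝ) :
    lmarginal (fun _ => (volume : Measure ℝ)) {k} (fun x => F (WithLp.toLp 2 x)) x =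
      ∫⁻ t : ℝ, F (WithLp.toLp 2 x + t • EuclideanSpace.single k (1 : ℝ)) := by
  rw [lmarginal_singleton]
  simp only
  rw [← lintegral_add_right_eq_self (μ := (volume : Measure ℝ))
    (fun t => F (WithLp.toLp 2 (Function.update x k t))) (x k)]
  simp_rw [toLp_update]

theorem enorm_sq_eq_sum {ι : Type*} [Fintype ι] (v : EuclideanSpace ℝ ι) : ‖v‖ₑ ^ 2 = ∑ k, ‖v k‖ₑ ^ 2 := by
  simp_rw [← ofReal_norm, ← ENNReal.ofReal_pow (norm_nonneg _)]
  rw [EuclideanSpace.norm_sq_eq, ENNReal.ofReal_sum_of_nonneg fun _ _ => by positivity]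

end Config

/-- Entropy bound for Sobolev functions: if `∫ f² ≤ 1` then `log f²` has an upper bound `U ≥ 0`
with `∫ f² U ≤ π⁻¹ ∫ |∇f|²`. -/
theorem HasWeakGradient.exists_log_bound {N d : ℕ} {f : Config N d → ℝ}
    {G : Config N d → Config N d} (hG : HasWeakGradient f G) (hf1 : ∫⁻ r, ‖f r‖ₑ ^ 2 ≤ 1) :
    ∃ U : Config N d → ℝ≥0∞, Measurable U ∧ (∀ᵐ r, ‖f r‖ₑ ^ 2 ≤ EReal.exp (U r)) ∧
      ∫⁻ r, ‖f r‖ₑ ^ 2 * U r ≤ ENNReal.ofReal (1 / Real.pi) * ∫⁻ r, ‖G r‖ₑ ^ 2 := by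
  classical
  rcases eq_or_ne (∫⁻ r, ‖G r‖ₑ ^ 2) ⊤ with hE | hE
  · refine ⟨fun _ => ⊤, measurable_const, by simp, ?_⟩
    rw [hE, ENNReal.mul_top (by simpa using Real.pi_pos)]
    exact le_top
  have hfm := hG.locallyIntegrable.aestronglyMeasurable
  have hGm := hG.locallyIntegrable_grad.aestronglyMeasurable
  set f' := hfm.mk f with hf'
  set G' := hGm.mk G with hG'
  have hff : f =ᵐ[volume] f' := hfm.ae_eq_mk
  have hGG : G =ᵐ[volume] G' := hGm.ae_eq_mk
  have hf'm : Measurable f' := hfm.stronglyMeasurable_mk.measurable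
  have hG'm : Measurable G' := hGm.stronglyMeasurable_mk.measurable
  have ef : ∫⁻ r, ‖f r‖ₑ ^ 2 = ∫⁻ r, ‖f' r‖ₑ ^ 2 :=
    lintegral_congr_ae (hff.mono fun r hr => by simp only [hr])
  have eG : ∫⁻ r, ‖G r‖ₑ ^ 2 = ∫⁻ r, ‖G' r‖ₑ ^ 2 :=
    lintegral_congr_ae (hGG.mono fun r hr => by simp only [hr])
  rw [ef] at hf1
  rw [eG] at hE ⊢
  have hk : ∀ k, Measurable fun r => G' r k := fun k => by fun_prop
  have hE' : ∀ k, ∫⁻ r, ‖G' r k‖ₑ ^ 2 ≠ ⊤ := fun k => by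
    refine ne_top_of_le_ne_top hE (lintegral_mono fun r => ?_)
    rw [enorm_sq_eq_sum]
    exact Finset.single_le_sum (f := fun k => ‖G' r k‖ₑ ^ 2) (fun _ _ => zero_le) (Finset.mem_univ k)
  have hfin : ∫⁻ r, ‖f' r‖ₑ ^ 2 ≠ ⊤ := ne_top_of_le_ne_top (by simp) hf1
  have hvp := PiLp.volume_preserving_toLp (Fin N × Fin d)
  have hvp' := PiLp.volume_preserving_ofLp (Fin N × Fin d)
  have hto : ∀ F : Config N d → ℝ≥0∞, Measurable F →
      ∫⁻ x : Fin N × Fin d → ℝ, F (WithLp.toLp 2 x) = ∫⁻ r, F r := fun F hF =>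
    hvp.lintegral_comp hF
  have hline : ∀ k, ∀ᵐ x : Fin N × Fin d → ℝ, ‖f' (WithLp.toLp 2 x)‖ₑ ^ 2 ≤
      lmarginal (fun _ => (volume : Measure ℝ)) {k}
        (fun x => ‖f' (WithLp.toLp 2 x)‖ₑ * ‖G' (WithLp.toLp 2 x) k‖ₑ) x := by
    intro k
    have h1 := ae_enorm_sq_le_lintegral_line (μ := (volume : Measure (Config N d)))
      (e := EuclideanSpace.single k 1) hf'm (hk k) hfin (hE' k) (fun φ hφ hφc => by
        have h2 := hG.integral_eq φ hφ hφc (EuclideanSpace.single k 1)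
        have h3 : ∫ r, f r * fderiv ℝ φ r (EuclideanSpace.single k 1) =
            ∫ r, f' r * fderiv ℝ φ r (EuclideanSpace.single k 1) :=
          integral_congr_ae (hff.mono fun r hr => by simp only [hr])
        have h4 : ∫ r, φ r * inner ℝ (G r) (EuclideanSpace.single k 1) =
            ∫ r, φ r * G' r k :=
          integral_congr_ae (hGG.mono fun r hr => by
            simp only [hr, EuclideanSpace.inner_single_right]; simp)
        rw [← h3, h2, h4])
    have h2 := ae_lmarginal_lt_top (F := fun x => ‖f' (WithLp.toLp 2 x)‖ₑ ^ 2)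
      (by fun_prop) (by rw [hto (fun r => ‖f' r‖ₑ ^ 2) (by fun_prop)]; exact hfin) {k}
    filter_upwards [hvp.quasiMeasurePreserving.ae h1, h2] with x hx hx2
    rw [lmarginal_singleton_comp_toLp (fun r => ‖f' r‖ₑ ^ 2)] at hx2
    rw [lmarginal_singleton_comp_toLp (fun r => ‖f' r‖ₑ * ‖G' r k‖ₑ)]
    exact hx hx2.ne
  obtain ⟨U, hUm, hU, hUi⟩ := EntropicBound.exists_log_bound
    (a := fun x => ‖f' (WithLp.toLp 2 x)‖ₑ) (b := fun k x => ‖G' (WithLp.toLp 2 x) k‖ₑ)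
    (by fun_prop) (by fun_prop)
    (by rw [hto (fun r => ‖f' r‖ₑ ^ 2) (by fun_prop)]; exact hf1) hline
  refine ⟨fun r => U (WithLp.ofLp r), by fun_prop, ?_, ?_⟩
  · filter_upwards [hvp'.quasiMeasurePreserving.ae hU, hff] with r hr hr'
    rw [hr']
    exact hr
  · have h5 : ∫⁻ r, ‖f r‖ₑ ^ 2 * U (WithLp.ofLp r) = ∫⁻ r, ‖f' r‖ₑ ^ 2 * U (WithLp.ofLp r) :=
      lintegral_congr_ae (hff.mono fun r hr => by simp only [hr])
    rw [h5, ← hto _ (by fun_prop)]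
    refine hUi.trans_eq ?_
    congr 1
    simp_rw [enorm_sq_eq_sum]
    rw [lintegral_finsetSum _ fun k _ => by fun_prop]
    exact Finset.sum_congr rfl fun k _ => hto (fun r => ‖G' r k‖ₑ ^ 2) (by fun_prop)

/-! ### From the logarithmic bound to entropy and energy -/

/-- The conventions `toReal ⊤ = 0` and `log 0 = 0` are harmless, as `V ≥ 0`. -/
theorem ofReal_log_toReal_le {h V : ℝ≥0∞} (hV : h ≤ EReal.exp V) :
    ENNReal.ofReal (Real.log h.toReal) ≤ V := by
  rcases eq_or_ne V ⊤ with h1 | h1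
  · simp [h1]
  lift V to NNReal using h1
  rcases eq_or_ne h.toReal 0 with h0 | h0
  · simp [h0]
  have hV' : h ≤ ENNReal.ofReal (Real.exp V) := hV
  have h2 : h.toReal ≤ Real.exp V := ENNReal.toReal_le_of_le_ofReal (Real.exp_pos _).le hV'
  have h3 : Real.log h.toReal ≤ V :=
    (Real.log_le_iff_le_exp (lt_of_le_of_ne ENNReal.toReal_nonneg h0.symm)).2 h2
  exact ENNReal.ofReal_le_of_le_toReal (by simpa using h3)

theorem measurable_coulomb {N d : ℕ} : Measurable (coulomb : Config N d → ℝ≥0∞) := by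
  unfold coulomb position
  fun_prop

/-- Finiteness of `R` excludes the default value `⊤`; the negative part is then dropped. -/
theorem relEntropy_le_of_llr_le {α : Type*} [MeasurableSpace α] {μ ν : Measure α} {R : ℝ≥0∞}
    (hac : μ ≪ ν) (hR : R ≠ ⊤) (h : ∫⁻ x, ENNReal.ofReal (llr μ ν x) ∂μ ≤ R) :
    relEntropy μ ν ≤ R := by
  unfold relEntropy
  rw [if_pos ⟨hac, ne_top_of_le_ne_top hR h⟩]
  refine le_trans ?_ (EReal.coe_ennreal_le_coe_ennreal_iff.2 h)
  exact EReal.sub_le_of_le_add' (le_add_of_nonneg_left (EReal.coe_ennreal_nonneg _))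

/-- The relative entropy of `|ψ|²` with respect to `η_T` is controlled by the energy of `ψ`. -/
theorem relEntropy_bornMeasure_le {N d : ℕ} {T : ℝ} (hT : 0 < T) {ψ : Config N d → ℝ}
    {G : Config N d → Config N d} (hG : HasWeakGradient ψ G)
    (hψ : IsProbabilityMeasure (bornMeasure ψ)) :
    relEntropy (bornMeasure ψ) (refMeasure N d T) ≤
      ((ENNReal.ofReal (1 / Real.pi) * (∫⁻ r, ‖G r‖ₑ ^ 2) +
        (∫⁻ r, coulomb r ∂(bornMeasure ψ)) / ENNReal.ofReal T : ℝ≥0∞) : EReal) := by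
  rcases eq_or_ne (ENNReal.ofReal (1 / Real.pi) * (∫⁻ r, ‖G r‖ₑ ^ 2) +
    (∫⁻ r, coulomb r ∂(bornMeasure ψ)) / ENNReal.ofReal T) ⊤ with hR | hR
  · rw [hR]; exact le_top
  have hT0 : ENNReal.ofReal T ≠ 0 := by simpa using hT
  have hg : AEMeasurable (fun r => ‖ψ r‖ₑ ^ 2) volume :=
    hG.locallyIntegrable.aestronglyMeasurable.aemeasurable.enorm.pow_const 2
  have hborn : bornMeasure ψ = volume.withDensity fun r => ‖ψ r‖ₑ ^ 2 := by
    unfold bornMeasure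
    congr 1; ext r
    rw [← enorm_pow, Real.enorm_eq_ofReal (sq_nonneg _)]
  have hint : ∀ F : Config N d → ℝ≥0∞, Measurable F →
      ∫⁻ r, F r ∂(bornMeasure ψ) = ∫⁻ r, ‖ψ r‖ₑ ^ 2 * F r := fun F hF => by
    rw [hborn, lintegral_withDensity_eq_lintegral_mul₀ hg hF.aemeasurable]; rfl
  have hone : ∫⁻ r, ‖ψ r‖ₑ ^ 2 ≤ 1 := by
    have h1 := hint 1 measurable_one
    simp only [Pi.one_apply, mul_one, lintegral_one, measure_univ] at h1
    exact h1.symm.le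
  obtain ⟨U, hUm, hU, hUi⟩ := hG.exists_log_bound hone
  have hCfin : ∫⁻ r, coulomb r ∂(bornMeasure ψ) ≠ ⊤ := by
    intro h
    rw [h, ENNReal.top_div_of_ne_top ENNReal.ofReal_ne_top, add_top] at hR
    exact hR rfl
  have hcm := measurable_coulomb (N := N) (d := d)
  set x : Config N d → ℝ≥0∞ := fun r => coulomb r / ENNReal.ofReal T with hx
  have hxm : Measurable x := hcm.div_const _
  set w : Config N d → ℝ≥0∞ := fun r => EReal.exp (-(x r : EReal)) with hw
  have hwm : Measurable w := hxm.coe_ereal_ennreal.neg.ereal_exp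
  -- The expected density of `|ψ|² dr` with respect to `η_T`.
  set h : Config N d → ℝ≥0∞ := fun r => ‖ψ r‖ₑ ^ 2 * EReal.exp (x r : EReal) with hh
  have hem : Measurable fun r => EReal.exp (x r : EReal) := hxm.coe_ereal_ennreal.ereal_exp
  have hhm : AEMeasurable h volume := hg.mul hem.aemeasurable
  have hη : refMeasure N d T = volume.withDensity w := rfl
  have hwle : ∀ r, w r ≤ 1 := fun r => by
    simp [hw, EReal.coe_ennreal_nonneg]
  have hηac : refMeasure N d T ≪ volume := withDensity_absolutelyContinuous _ _
  have hsf : SigmaFinite (refMeasure N d T) := by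
    rw [hη]
    exact SigmaFinite.withDensity_of_ne_top
      (Filter.Eventually.of_forall fun r => ne_top_of_le_ne_top (by simp) (hwle r))
  have hγ : bornMeasure ψ = (refMeasure N d T).withDensity h := by
    rw [hη, ← withDensity_mul₀ hwm.aemeasurable hhm, hborn]
    refine withDensity_congr_ae ?_
    -- The weight of `η_T` vanishes where `C = ∞`; finite Coulomb energy makes `ψ` vanish almost
    -- everywhere there, so no mass is lost.
    have h1 : ∀ᵐ r, ‖ψ r‖ₑ ^ 2 * coulomb r < ⊤ :=
      ae_lt_top' (hg.mul hcm.aemeasurable) (by rw [← hint _ hcm]; exact hCfin)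
    filter_upwards [h1] with r hr
    simp only [Pi.mul_apply, hw, hh]
    rcases eq_or_ne (coulomb r) ⊤ with hc | hc
    · rw [hc] at hr
      have : ‖ψ r‖ₑ ^ 2 = 0 := by
        by_contra h0
        rw [ENNReal.mul_top h0] at hr
        exact hr.ne rfl
      rw [this]; simp
    · have hxt : x r ≠ ⊤ := ENNReal.div_ne_top hc hT0
      rw [mul_left_comm, EReal.exp_neg, ENNReal.inv_mul_cancel (by simp)
        (by simpa using hxt), mul_one]
  have hac : bornMeasure ψ ≪ refMeasure N d T := by
    rw [hγ]; exact withDensity_absolutelyContinuous _ _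
  have hrn : (bornMeasure ψ).rnDeriv (refMeasure N d T) =ᵐ[bornMeasure ψ] h := by
    refine hac.ae_eq ?_
    rw [hγ]
    exact Measure.rnDeriv_withDensity₀ _ (hhm.mono_ac hηac)
  refine relEntropy_le_of_llr_le hac hR ?_
  calc ∫⁻ r, ENNReal.ofReal (llr (bornMeasure ψ) (refMeasure N d T) r) ∂(bornMeasure ψ)
      ≤ ∫⁻ r, (U r + x r) ∂(bornMeasure ψ) := by
        refine lintegral_mono_ae ?_
        filter_upwards [hrn, (hac.trans hηac).ae_le hU] with r hr hUr
        simp only [llr, hr]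
        refine ofReal_log_toReal_le ?_
        rw [EReal.coe_ennreal_add, EReal.exp_add]
        exact mul_le_mul_left hUr _
    _ = (∫⁻ r, ‖ψ r‖ₑ ^ 2 * U r) + (∫⁻ r, coulomb r ∂(bornMeasure ψ)) / ENNReal.ofReal T := by
        rw [lintegral_add_left hUm, hint U hUm]
        congr 1
        simp_rw [hx, div_eq_mul_inv]
        rw [lintegral_mul_const _ hcm]
    _ ≤ _ := by gcongr

theorem mul_energy_eq {hbar T : ℝ} (hhbar : 0 < hbar) (hT : T = Real.pi * hbar ^ 2 / 2)
    (D C : ℝ≥0∞) :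
    ENNReal.ofReal T * (ENNReal.ofReal (1 / Real.pi) * D + C / ENNReal.ofReal T) =
      ENNReal.ofReal (hbar ^ 2 / 2) * D + C := by
  have hpi := Real.pi_pos
  have hT0 : 0 < T := by rw [hT]; positivity
  rw [mul_add, ENNReal.mul_div_cancel (by simpa using hT0) ENNReal.ofReal_ne_top, ← mul_assoc,
    ← ENNReal.ofReal_mul hT0.le]
  congr 3
  rw [hT]; field_simp

theorem le_levyLieb_of_forall {N d : ℕ} {hbar : ℝ} (hhbar : 0 < hbar)
    {ρ : Measure (EuclideanSpace ℝ (Fin d))} {S : EReal}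
    (h : ∀ (ψ : Config N d → ℝ) (G : Config N d → Config N d), HasWeakGradient ψ G →
      IsPlan ρ (bornMeasure ψ) →
      S ≤ ((ENNReal.ofReal (hbar ^ 2 / 2) * (∫⁻ r, ‖G r‖ₑ ^ 2) +
        ∫⁻ r, coulomb r ∂(bornMeasure ψ) : ℝ≥0∞) : EReal)) :
    S ≤ (levyLieb N hbar ρ : EReal) := by
  -- `S` may be negative while the energies are not, so it can be replaced by its positive part.
  -- Multiplication by the finite nonzero `ħ²/2` then commutes with the infima defining the
  -- Dirichlet energy.
  suffices H : S.toENNReal ≤ levyLieb N hbar ρ from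
    (EReal.coe_toENNReal_eq_max (x := S) ▸ le_max_right _ _ : S ≤ S.toENNReal).trans (EReal.coe_ennreal_le_coe_ennreal_iff.2 H)
  refine le_iInf fun ψ => le_iInf fun _ => le_iInf fun hplan => ?_
  unfold dirichletEnergy
  have h0 : ENNReal.ofReal (hbar ^ 2 / 2) ≠ 0 := by
    simp only [ne_eq, ENNReal.ofReal_eq_zero, not_le]; positivity
  rw [ENNReal.mul_iInf_of_ne h0 ENNReal.ofReal_ne_top, ENNReal.iInf_add]
  refine le_iInf fun G => ?_
  rw [ENNReal.mul_iInf_of_ne h0 ENNReal.ofReal_ne_top, ENNReal.iInf_add]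
  refine le_iInf fun hG => ?_
  simpa only [EReal.toENNReal_coe] using EReal.toENNReal_le_toENNReal (h ψ G hG hplan)

theorem entropicValue_le_energy {N d : ℕ} {T : ℝ} (hT : 0 < T)
    {ρ : Measure (EuclideanSpace ℝ (Fin d))} {ψ : Config N d → ℝ}
    {G : Config N d → Config N d} (hG : HasWeakGradient ψ G) (hψ : IsPlan ρ (bornMeasure ψ)) :
    entropicValue N T ρ ≤ ((ENNReal.ofReal (1 / Real.pi) * (∫⁻ r, ‖G r‖ₑ ^ 2) +
        (∫⁻ r, coulomb r ∂(bornMeasure ψ)) / ENNReal.ofReal T : ℝ≥0∞) : EReal) :=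
  (iInf₂_le _ hψ).trans (relEntropy_bornMeasure_le hT hG hψ.isProbabilityMeasure)

end EntropicBound

theorem mainTheorem6 (N d : ℕ) (hN : 1 ≤ N) (hd : 1 ≤ d) (hbar : ℝ) (hhbar : 0 < hbar)
    (T : ℝ) (hT : T = Real.pi * hbar ^ 2 / 2)
    (ρ : Measure (EuclideanSpace ℝ (Fin d))) [IsProbabilityMeasure ρ] :
    (T : EReal) * EntropicBound.entropicValue N T ρ ≤ (EntropicBound.levyLieb N hbar ρ : EReal) ∧
      (1 ≤ T →
        EntropicBound.entropicValue N T ρ ≤ (EntropicBound.levyLieb N hbar ρ : EReal)) := by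
  have hT0 : 0 < T := by rw [hT]; have := Real.pi_pos; positivity
  refine ⟨EntropicBound.le_levyLieb_of_forall hhbar fun ψ G hG hψ => ?_,
    fun hT1 => EntropicBound.le_levyLieb_of_forall hhbar fun ψ G hG hψ => ?_⟩
  · rw [← EntropicBound.mul_energy_eq hhbar hT, EReal.coe_ennreal_mul, EReal.coe_ennreal_ofReal,
      max_eq_left hT0.le]
    exact mul_le_mul_of_nonneg_left (EntropicBound.entropicValue_le_energy hT0 hG hψ)
      (by exact_mod_cast hT0.le)
  · rw [← EntropicBound.mul_energy_eq hhbar hT]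
    refine (EntropicBound.entropicValue_le_energy hT0 hG hψ).trans
      (EReal.coe_ennreal_le_coe_ennreal_iff.2 ?_)
    -- The factor `T ≥ 1` multiplies the nonnegative upper bound, not the entropic value, whose sign
    -- is unknown.
    exact le_mul_of_one_le_left' (by simpa using hT1)
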